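/- Let $R$ be a commutative ring and let $(\mathcal C,\mathbb E,\mathfrak s)$ be an $R$-linear extriangulated category in the sense of Nakaoka and Palu. "Class" means class of objects of $\mathcal C$. For $i\ge 1$ let $\mathbb E^i$ be the higher extension functors, $\mathbb E^1=\mathbb E$ and $\mathbb E^{i+1}(-,A)=\mathbb E^{i}(-,A)\otimes_{\mathcal C}\mathbb E$. For a class $\mathcal X$ let ${}^{\perp}\mathcal X=\{M : \mathbb E^i(M,X)=0 \text{ for all } X\in\mathcal X,\ i\ge 1\}$. A class $\mathcal X$ is closed under extensions if $B\in\mathcal X$ for every $\mathbb E$-triangle $A\to B\to C\dashrightarrow$ with $A,C\in\mathcal X$. A class $\omega$ is a relative generator in $\mathcal X$ if $\omega\subseteq\mathcal X$ and every $X\in\mathcal X$ admits an $\mathbb E$-triangle $X'\to W\to X\dashrightarrow$ with $W\in\omega$ and $X'\in\mathcal X$. For a class $\mathcal Z$, a morphism $f:Z\to M$ is a $\mathcal Z$-precover if $Z\in\mathcal Z$ and $\mathrm{Hom}(Z',f)$ is surjective for all $Z'\in\mathcal Z$; a $\mathcal Z$-preenvelope is defined dually. For classes $\mathcal A,\mathcal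 B$, a finite $\mathcal B_{\mathcal A}$-coresolution of $M$ of length $n$ is a sequence $M\to B_0\to\cdots\to B_n$ obtained by splicing $\mathbb E$-triangles $N_{k-1}\to B_k\to N_k\dashrightarrow$ $(0\le k<n)$, with $N_{-1}=M$, $N_{n-1}\cong B_n$, $B_k\in\mathcal B$ and $N_k\in\mathcal A$ for $0\le k<n$, and $B_n\in\mathcal A\cap\mathcal B$ (for $n=0$: $M\cong B_0\in\mathcal A\cap\mathcal B$). Let $\mathcal B^{\vee}_{\mathcal A}$ be the class of objects having such a coresolution, $\mathcal B^\vee=\mathcal B^\vee_{\mathcal C}$, $(\mathcal A,\mathcal B)^\vee=\mathcal A\cap\mathcal B^\vee_{\mathcal A}$, and let $\mathrm{coresdim}^{\mathcal A}_{\mathcal B}(M)$ be the least length of such a coresolution ($\infty$ if there is none). **Theorem.** Let $\mathcal X\subseteq\mathcal Y$ be classes that are both closed under extensions, let $\omega$ be a relative generator in $\mathcal X$, and let $0\in\mathcal X$. (1) Let $Z\in\mathcal X^\vee_{\mathcal Y}$ and $n=\mathrm{coresdim}^{\mathcal Y}_{\mathcal X}(Z)$. There are $\mathbb E$-triangles $$Z\xrightarrow{g_Z}M_Z\to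 C_Z\dashrightarrow\quad\text{with } M_Z\in\mathcal X,\ C_Z\in(\mathcal Y,\omega)^\vee,$$ $$K_Z\to B_Z\xrightarrow{f_Z}Z\dashrightarrow\quad\text{with } K_Z\in\mathcal X,\ B_Z\in\omega^\vee_{\mathcal Y},$$ such that $\mathrm{coresdim}^{\mathcal Y}_{\omega}(B_Z)\le n$, and $\mathrm{coresdim}^{\mathcal Y}_{\omega}(C_Z)=n-1$ if $n\ge 1$, while $C_Z=0$ if $n=0$. (2) For every $\mathbb E$-triangle $K_Z\to B_Z\to Z\dashrightarrow$ with $K_Z\in\mathcal X$ and $B_Z\in\omega^\vee_{\mathcal Y}$ (in particular for the one in (1)): if $Z\in(\mathcal Y,\mathcal X)^\vee$, then $B_Z\in(\mathcal Y,\omega)^\vee$. (3) Suppose $\omega\subseteq{}^\perp\mathcal X$. Then $\omega^\vee\subseteq{}^\perp\mathcal X$. Moreover, for every $\mathbb E$-triangle $K_Z\to B_Z\xrightarrow{f_Z}Z\dashrightarrow$ with $K_Z\in\mathcal X$ and $B_Z\in\omega^\vee_{\mathcal Y}$, the morphism $f_Z$ is an $\omega^\vee$-precover, and for every $\mathbb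 E$-triangle $Z\xrightarrow{g_Z}M_Z\to C_Z\dashrightarrow$ with $M_Z\in\mathcal X$ and $C_Z\in(\mathcal Y,\omega)^\vee$, the morphism $g_Z$ is an $\mathcal X$-preenvelope (in particular, this holds for the triangles in (1)). -/

import Mathlib

open CategoryTheory CategoryTheory.Limits Opposite
open scoped TensorProduct

universe w v u r

namespace Extri

section Bifunctor

variable {R : Type r} [CommRing R] {C : Type u} [Category.{v} C]

/-- For a bifunctor `E`, the module `E(Z, A)` of `E`-extensions of `Z` by `A`
(contravariant in `Z`, covariant in `A`). -/
abbrev Extn (E : Cᵒᵖ ⥤ C ⥤ ModuleCat.{w} R) (Z A : C) : Type w :=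
  (E.obj (op Z)).obj A

/-- The map `a_* : E(Z, A) → E(Z, A')` induced by `a : A ⟶ A'`. -/
def push (E : Cᵒᵖ ⥤ C ⥤ ModuleCat.{w} R) (Z : C) {A A' : C} (a : A ⟶ A') :
    Extn E Z A →ₗ[R] Extn E Z A' :=
  ((E.obj (op Z)).map a).hom

/-- The map `c^* : E(Z, A) → E(Z', A)` induced by `c : Z' ⟶ Z`. -/
def pull (E : Cᵒᵖ ⥤ C ⥤ ModuleCat.{w} R) (A : C) {Z' Z : C} (c : Z' ⟶ Z) :
    Extn E Z A →ₗ[R] Extn E Z' A :=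
  ((E.map c.op).app A).hom

lemma push_pull (E : Cᵒᵖ ⥤ C ⥤ ModuleCat.{w} R) {A A' Z' Z : C} (a : A ⟶ A') (c : Z' ⟶ Z)
    (δ : Extn E Z A) : push E Z' a (pull E A c δ) = pull E A' c (push E Z a δ) :=
  (congrArg (fun f => f.hom δ) ((E.map c.op).naturality a)).symm

lemma pull_id (E : Cᵒᵖ ⥤ C ⥤ ModuleCat.{w} R) (A Z : C) : pull E A (𝟙 Z) = LinearMap.id := by
  simp [pull]

lemma pull_comp (E : Cᵒᵖ ⥤ C ⥤ ModuleCat.{w} R) (A : C) {Z'' Z' Z : C} (d : Z'' ⟶ Z')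
    (c : Z' ⟶ Z) : pull E A (d ≫ c) = pull E A d ∘ₗ pull E A c := by
  simp [pull]

/-- The direct sum `δ ⊕ δ' ∈ E(Z ⊕ Z', A ⊕ A')` of two extensions: its four components
are `δ`, `0`, `0`, `δ'`. -/
noncomputable def dirSum [Preadditive C] [HasBinaryBiproducts C]
    (E : Cᵒᵖ ⥤ C ⥤ ModuleCat.{w} R) {Z A Z' A' : C}
    (δ : Extn E Z A) (δ' : Extn E Z' A') : Extn E (Z ⊞ Z') (A ⊞ A') :=
  push E _ biprod.inl (pull E A biprod.fst δ) + push E _ biprod.inr (pull E A' biprod.snd δ')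

/-! ### Higher extensions

`E^1 = E` and `E^{k+1}(-, A) = E^k(-, A) ⊗_C E`, the tensor product of functors over `C`. -/

section Tensor

variable (E : Cᵒᵖ ⥤ C ⥤ ModuleCat.{w} R) (P : Cᵒᵖ ⥤ ModuleCat.{max u w} R)

/-- `⨁_M P(M) ⊗_R E(Z, M)`. -/
abbrev PreTensor (Z : C) : Type (max u w) :=
  DirectSum C fun M => (P.obj (op M) : Type (max u w)) ⊗[R] Extn E Z M

open Classical in
/-- The generator `x ⊗ δ` in the summand of index `M`. -/
noncomputable def preTmul (Z M : C) (x : P.obj (op M)) (δ : Extn E Z M) : PreTensor E P Z :=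
  DirectSum.lof R C (fun M => (P.obj (op M) : Type (max u w)) ⊗[R] Extn E Z M) M (x ⊗ₜ[R] δ)

/-- The relations `f^* x ⊗ δ = x ⊗ f_* δ` of the coend, for `f : M ⟶ N`. -/
def tensorRel (Z : C) : Submodule R (PreTensor E P Z) :=
  Submodule.span R {t | ∃ (M N : C) (f : M ⟶ N) (x : P.obj (op N)) (δ : Extn E Z M),
    t = preTmul E P Z M ((P.map f.op).hom x) δ - preTmul E P Z N x (push E Z f δ)}

open Classical in
/-- The map `⨁_M P(M) ⊗ E(Z, M) → ⨁_M P(M) ⊗ E(Z', M)` induced by `c : Z' ⟶ Z`. -/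
noncomputable def preTensorMap {Z' Z : C} (c : Z' ⟶ Z) :
    PreTensor E P Z →ₗ[R] PreTensor E P Z' :=
  DirectSum.toModule R C _ fun M =>
    DirectSum.lof R C (fun M => (P.obj (op M) : Type (max u w)) ⊗[R] Extn E Z' M) M ∘ₗ
      TensorProduct.map LinearMap.id (pull E M c)

lemma preTensorMap_preTmul {Z' Z : C} (c : Z' ⟶ Z) (M : C) (x : P.obj (op M))
    (δ : Extn E Z M) :
    preTensorMap E P c (preTmul E P Z M x δ) = preTmul E P Z' M x (pull E M c δ) := by
  classical
  simp [preTensorMap, preTmul, DirectSum.toModule_lof]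

lemma preTensor_hom_ext {Z : C} {V : Type*} [AddCommGroup V] [Module R V]
    {f g : PreTensor E P Z →ₗ[R] V}
    (h : ∀ M x δ, f (preTmul E P Z M x δ) = g (preTmul E P Z M x δ)) : f = g := by
  classical
  refine DirectSum.linearMap_ext R fun M => TensorProduct.ext' fun x δ => ?_
  exact h M x δ

lemma tensorRel_le_comap {Z' Z : C} (c : Z' ⟶ Z) :
    tensorRel E P Z ≤ (tensorRel E P Z').comap (preTensorMap E P c) := by
  refine Submodule.span_le.2 ?_
  rintro _ ⟨M, N, f, x, δ, rfl⟩
  refine Submodule.subset_span ⟨M, N, f, x, pull E M c δ, ?_⟩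
  rw [map_sub, preTensorMap_preTmul, preTensorMap_preTmul, push_pull]

/-- The functor `P ⊗_C E`, with value at `Z` the coend of `P(M) ⊗ E(Z, M)` over `M`. -/
noncomputable def tensorFunctor : Cᵒᵖ ⥤ ModuleCat.{max u w} R where
  obj Z := ModuleCat.of R (PreTensor E P Z.unop ⧸ tensorRel E P Z.unop)
  map c := ModuleCat.ofHom (Submodule.mapQ _ _ (preTensorMap E P c.unop)
    (tensorRel_le_comap E P c.unop))
  map_id Z := by
    ext1
    refine Submodule.linearMap_qext _ (preTensor_hom_ext E P fun M x δ => ?_)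
    simp [preTensorMap_preTmul, pull_id]
  map_comp c d := by
    ext1
    refine Submodule.linearMap_qext _ (preTensor_hom_ext E P fun M x δ => ?_)
    simp [preTensorMap_preTmul, pull_comp]

end Tensor

/-- `higherExt E A k` is the functor `E^{k+1}(-, A)`. -/
noncomputable def higherExt (E : Cᵒᵖ ⥤ C ⥤ ModuleCat.{w} R) (A : C) :
    ℕ → (Cᵒᵖ ⥤ ModuleCat.{max u w} R)
  | 0 => E.flip.obj A ⋙ ModuleCat.uliftFunctor.{u, w} R
  | k + 1 => tensorFunctor E (higherExt E A k)

end Bifunctor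

/-- An `R`-linear extriangulated structure `(C, E, s)` on an `R`-linear additive category `C`.
The realization `s` is encoded by the relation `Realizes δ x y`, which says that the sequence
`A --x--> B --y--> Z` belongs to the equivalence class `s(δ)`. -/
structure Extriangulated (R : Type r) [CommRing R] (C : Type u) [Category.{v} C]
    [Preadditive C] [Linear R C] [HasZeroObject C] [HasBinaryBiproducts C] where
  /-- the bifunctor of extensions -/
  E : Cᵒᵖ ⥤ C ⥤ ModuleCat.{w} R
  push_add : ∀ {Z A A' : C} (a b : A ⟶ A') (δ : Extn E Z A),
    push E Z (a + b) δ = push E Z a δ + push E Z b δ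
  push_smul : ∀ {Z A A' : C} (t : R) (a : A ⟶ A') (δ : Extn E Z A),
    push E Z (t • a) δ = t • push E Z a δ
  pull_add : ∀ {A Z' Z : C} (c d : Z' ⟶ Z) (δ : Extn E Z A),
    pull E A (c + d) δ = pull E A c δ + pull E A d δ
  pull_smul : ∀ {A Z' Z : C} (t : R) (c : Z' ⟶ Z) (δ : Extn E Z A),
    pull E A (t • c) δ = t • pull E A c δ
  /-- `A --x--> B --y--> Z` represents `s(δ)` -/
  Realizes : ∀ {A B Z : C}, Extn E Z A → (A ⟶ B) → (B ⟶ Z) → Prop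
  /-- `s(δ)` is one whole equivalence class of sequences -/
  exists_realizes : ∀ {A Z : C} (δ : Extn E Z A),
    ∃ (B : C) (x : A ⟶ B) (y : B ⟶ Z), Realizes δ x y
  realizes_iff : ∀ {A B B' Z : C} {δ : Extn E Z A} {x : A ⟶ B} {y : B ⟶ Z},
    Realizes δ x y → ∀ (x' : A ⟶ B') (y' : B' ⟶ Z),
      (Realizes δ x' y' ↔ ∃ b : B ≅ B', x ≫ b.hom = x' ∧ b.hom ≫ y' = y)
  /-- `s` is a realization: morphisms of extensions are realized -/
  exists_mid : ∀ {A B Z A' B' Z' : C} {δ : Extn E Z A} {x : A ⟶ B} {y : B ⟶ Z}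
    {δ' : Extn E Z' A'} {x' : A' ⟶ B'} {y' : B' ⟶ Z'},
    Realizes δ x y → Realizes δ' x' y' → ∀ (a : A ⟶ A') (c : Z ⟶ Z'),
      push E Z a δ = pull E A' c δ' →
      ∃ b : B ⟶ B', x ≫ b = a ≫ x' ∧ y ≫ c = b ≫ y'
  /-- `s` is additive -/
  realizes_zero : ∀ A Z : C,
    Realizes (0 : Extn E Z A) (biprod.inl : A ⟶ A ⊞ Z) (biprod.snd : A ⊞ Z ⟶ Z)
  realizes_dirSum : ∀ {A B Z A' B' Z' : C} {δ : Extn E Z A} {x : A ⟶ B} {y : B ⟶ Z}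
    {δ' : Extn E Z' A'} {x' : A' ⟶ B'} {y' : B' ⟶ Z'},
    Realizes δ x y → Realizes δ' x' y' →
      Realizes (dirSum E δ δ') (biprod.map x x') (biprod.map y y')
  /-- (ET3) -/
  exists_right : ∀ {A B Z A' B' Z' : C} {δ : Extn E Z A} {x : A ⟶ B} {y : B ⟶ Z}
    {δ' : Extn E Z' A'} {x' : A' ⟶ B'} {y' : B' ⟶ Z'},
    Realizes δ x y → Realizes δ' x' y' → ∀ (a : A ⟶ A') (b : B ⟶ B'),
      x ≫ b = a ≫ x' →
      ∃ c : Z ⟶ Z', push E Z a δ = pull E A' c δ' ∧ y ≫ c = b ≫ y'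
  /-- (ET3)ᵒᵖ -/
  exists_left : ∀ {A B Z A' B' Z' : C} {δ : Extn E Z A} {x : A ⟶ B} {y : B ⟶ Z}
    {δ' : Extn E Z' A'} {x' : A' ⟶ B'} {y' : B' ⟶ Z'},
    Realizes δ x y → Realizes δ' x' y' → ∀ (b : B ⟶ B') (c : Z ⟶ Z'),
      y ≫ c = b ≫ y' →
      ∃ a : A ⟶ A', push E Z a δ = pull E A' c δ' ∧ x ≫ b = a ≫ x'
  /-- (ET4) -/
  octahedron : ∀ {A B D G F : C} {δ : Extn E D A} {f : A ⟶ B} {f' : B ⟶ D}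
    {δ' : Extn E F B} {g : B ⟶ G} {g' : G ⟶ F},
    Realizes δ f f' → Realizes δ' g g' →
      ∃ (H : C) (h' : G ⟶ H) (d : D ⟶ H) (e : H ⟶ F) (δ'' : Extn E H A),
        Realizes δ'' (f ≫ g) h' ∧ f' ≫ d = g ≫ h' ∧ h' ≫ e = g' ∧
        Realizes (push E F f' δ') d e ∧
        pull E A d δ'' = δ ∧
        push E H f δ'' = pull E B e δ'
  /-- (ET4)ᵒᵖ -/
  octahedron_op : ∀ {D A B F G : C} {δ : Extn E B D} {f' : D ⟶ A} {f : A ⟶ B}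
    {δ' : Extn E G F} {g' : F ⟶ B} {g : B ⟶ G},
    Realizes δ f' f → Realizes δ' g' g →
      ∃ (H : C) (d : D ⟶ H) (e : H ⟶ F) (h' : H ⟶ A) (δ'' : Extn E G H),
        Realizes δ'' h' (f ≫ g) ∧ d ≫ h' = f' ∧ h' ≫ f = e ≫ g' ∧
        Realizes (pull E D g' δ) d e ∧
        push E G e δ'' = δ' ∧
        push E B d δ = pull E H g δ''

section Relative

variable {C : Type u} [Category.{v} C]

/-- `f : Z ⟶ M` is a `𝒵`-precover. -/
def IsPrecover (𝒵 : ObjectProperty C) {Z M : C} (f : Z ⟶ M) : Prop :=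
  𝒵 Z ∧ ∀ Z' : C, 𝒵 Z' → Function.Surjective fun g : Z' ⟶ Z => g ≫ f

/-- `f : M ⟶ Z` is a `𝒵`-preenvelope. -/
def IsPreenvelope (𝒵 : ObjectProperty C) {M Z : C} (f : M ⟶ Z) : Prop :=
  𝒵 Z ∧ ∀ Z' : C, 𝒵 Z' → Function.Surjective fun g : Z ⟶ Z' => f ≫ g

variable {R : Type r} [CommRing R] [Preadditive C] [Linear R C] [HasZeroObject C]
  [HasBinaryBiproducts C] (T : Extriangulated.{w} R C)

/-- `A --x--> B --y--> Z` is (the underlying sequence of) an `E`-triangle. -/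
def IsTriangle {A B Z : C} (x : A ⟶ B) (y : B ⟶ Z) : Prop :=
  ∃ δ : Extn T.E Z A, T.Realizes δ x y

/-- The class `𝒳` is closed under extensions. -/
def ClosedUnderExt (𝒳 : ObjectProperty C) : Prop :=
  ∀ ⦃A B Z : C⦄ (x : A ⟶ B) (y : B ⟶ Z), IsTriangle T x y → 𝒳 A → 𝒳 Z → 𝒳 B

/-- `ω` is a relative generator in `𝒳`. -/
def IsRelGenerator (ω 𝒳 : ObjectProperty C) : Prop :=
  ω ≤ 𝒳 ∧ ∀ X : C, 𝒳 X → ∃ (X' W : C) (x : X' ⟶ W) (y : W ⟶ X),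
    IsTriangle T x y ∧ 𝒳 X' ∧ ω W

/-- The left orthogonal class `⊥𝒳`: the objects `M` with `E^i(M, X) = 0` for all `X` in `𝒳`
and all `i ≥ 1`. -/
def leftOrth (𝒳 : ObjectProperty C) : ObjectProperty C := fun M =>
  ∀ X : C, 𝒳 X → ∀ k : ℕ, ∀ ξ : (higherExt T.E X k).obj (op M), ξ = 0

/-- `HasCores T 𝒳 𝒴 n M`: there is a finite `𝒴_𝒳`-coresolution `M → Y₀ → ⋯ → Yₙ` of length `n`,
that is, `E`-triangles `N_{k-1} → Y_k → N_k` for `0 ≤ k < n`, with `N_{-1} = M`, `N_{n-1} ≅ Yₙ`,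
`Y_k ∈ 𝒴` and `N_k ∈ 𝒳` for `0 ≤ k < n`, and `Yₙ ∈ 𝒳 ∩ 𝒴`. For `n = 0` this means `M ≅ Y₀`. -/
def HasCores (𝒳 𝒴 : ObjectProperty C) : ℕ → C → Prop
  | 0, M => (𝒳 ⊓ 𝒴).isoClosure M
  | n + 1, M => ∃ (Y N : C) (x : M ⟶ Y) (y : Y ⟶ N),
      IsTriangle T x y ∧ 𝒴 Y ∧ 𝒳 N ∧ HasCores 𝒳 𝒴 n N

/-- The `𝒴_𝒳`-coresolution dimension `coresdim^𝒳_𝒴(M)`, which is `⊤` if there is no finite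
`𝒴_𝒳`-coresolution. -/
noncomputable def coresdim (𝒳 𝒴 : ObjectProperty C) (M : C) : ℕ∞ :=
  sInf {m : ℕ∞ | ∃ k : ℕ, m = k ∧ HasCores T 𝒳 𝒴 k M}

/-- The class `𝒴^∨_𝒳` of the objects with a finite `𝒴_𝒳`-coresolution. The class `𝒴^∨`
is the case where `𝒳 = ⊤` consists of all objects. -/
def coresClass (𝒳 𝒴 : ObjectProperty C) : ObjectProperty C := fun M =>
  ∃ n : ℕ, HasCores T 𝒳 𝒴 n M

/-- The class `(𝒳, 𝒴)^∨ = 𝒳 ∩ 𝒴^∨_𝒳`. -/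
def pairClass (𝒳 𝒴 : ObjectProperty C) : ObjectProperty C :=
  𝒳 ⊓ coresClass T 𝒳 𝒴

end Relative

end Extri

universe t

namespace Extri

section Bifunctor

variable {R : Type r} [CommRing R] {C : Type u} [Category.{v} C] (E : Cᵒᵖ ⥤ C ⥤ ModuleCat.{w} R)

/-! Parts (1) and (2) are an Auslander–Buchweitz argument. Let `Z ⟶ X ⟶ N` begin an `𝒳`-coresolution
of `Z`, and let induction supply `K ⟶ B ⟶ N`. The fibre product `M` of `X` and `B` over `N` is an
extension of `X` by `K`, hence in `𝒳`, and sits in `Z ⟶ M ⟶ B` (`exists_triangle_pullback`).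
Covering `M` by an object `W` of `ω` and applying (ET4)ᵒᵖ gives `B' ⟶ W ⟶ B` and `K' ⟶ B' ⟶ Z`
(`exists_triangle_of_hasCores`). The dimension of `C_Z = B` cannot drop below `n - 1`, because an
`ω`-coresolution of `B` preceded by `M` is an `𝒳`-coresolution of `Z`. Part (2) is closure of `𝒴`
under extensions.

In (3), precovers and preenvelopes come from the vanishing of a single extension group. The
substance is `ω^∨ ⊆ ⊥𝒳`, a dimension shift that needs exactness of `E^k(B, X) ⟶ E^k(A, X) ⟶
E^{k+1}(Z, X)` for an `E`-triangle `A ⟶ B ⟶ Z`, with `E^k` defined by coends and no projectives or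
injectives at hand. For a cohomological presheaf `P` in place of `E^k`, the relation `ξ ⊗ δ = 0` is
tested in the direct limit, over all extensions of `Z`, of the cokernels of restriction from the
middle term to the left term. A class that dies in the limit is already zero at its own stage
(`exists_res_eq_of_push`), so `ξ` extends to `B` (`exists_res_eq_of_tmul_eq_zero`). This exactness
in turn makes `P ⊗ E` cohomological, which closes the induction on `k`. -/

lemma push_id (A Z : C) (δ : Extn E Z A) : push E Z (𝟙 A) δ = δ := by
  simp [push]

lemma push_comp (Z : C) {A A' A'' : C} (a : A ⟶ A') (b : A' ⟶ A'') (δ : Extn E Z A) :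
    push E Z (a ≫ b) δ = push E Z b (push E Z a δ) := by
  simp [push]

lemma pull_id_apply (A Z : C) (δ : Extn E Z A) : pull E A (𝟙 Z) δ = δ := by
  simp [pull]

lemma pull_comp_apply (A : C) {Z'' Z' Z : C} (d : Z'' ⟶ Z') (c : Z' ⟶ Z) (δ : Extn E Z A) :
    pull E A (d ≫ c) δ = pull E A d (pull E A c δ) := by
  simp [pull]

end Bifunctor

variable {R : Type r} [CommRing R] {C : Type u} [Category.{v} C] [Preadditive C] [Linear R C]
  [HasZeroObject C] [HasBinaryBiproducts C] (T : Extriangulated.{w} R C)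

/-! ### Elementary calculus of `E`-triangles -/

namespace Extriangulated

/-- Pushing forward a fixed extension is additive in the morphism. -/
def pushHom {Z A : C} (A' : C) (δ : Extn T.E Z A) : (A ⟶ A') →+ Extn T.E Z A' :=
  AddMonoidHom.mk' (fun a => push T.E Z a δ) fun a b => T.push_add a b δ

/-- Pulling back a fixed extension is additive in the morphism. -/
def pullHom {Z A : C} (Z' : C) (δ : Extn T.E Z A) : (Z' ⟶ Z) →+ Extn T.E Z' A :=
  AddMonoidHom.mk' (fun c => pull T.E A c δ) fun c d => T.pull_add c d δ

lemma push_zero {Z A A' : C} (δ : Extn T.E Z A) : push T.E Z (0 : A ⟶ A') δ = 0 :=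
  map_zero (T.pushHom A' δ)

lemma push_sub {Z A A' : C} (a b : A ⟶ A') (δ : Extn T.E Z A) :
    push T.E Z (a - b) δ = push T.E Z a δ - push T.E Z b δ :=
  map_sub (T.pushHom A' δ) a b

lemma pull_zero {Z' Z A : C} (δ : Extn T.E Z A) : pull T.E A (0 : Z' ⟶ Z) δ = 0 :=
  map_zero (T.pullHom Z' δ)

variable {T}

section

variable {A B Z : C} {δ : Extn T.E Z A} {x : A ⟶ B} {y : B ⟶ Z}

/-- A sequence with a splitting realizes the zero extension. -/
lemma realizes_zero_of_splitting {x : A ⟶ B} {y : B ⟶ Z} (p : B ⟶ A) (s : Z ⟶ B)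
    (hx : x ≫ p = 𝟙 A) (hs : s ≫ y = 𝟙 Z) (hxy : x ≫ y = 0) (hps : s ≫ p = 0)
    (h : p ≫ x + y ≫ s = 𝟙 B) : T.Realizes 0 x y := by
  refine (T.realizes_iff (T.realizes_zero A Z) x y).2
    ⟨⟨biprod.desc x s, biprod.lift p y, ?_, ?_⟩, ?_, ?_⟩
  · ext <;> simp [hx, hs, hxy, hps]
  · simp [h]
  · simp
  · ext <;> simp [hs, hxy]

/-- A sequence realizing the zero extension splits. -/
lemma exists_splitting (h : T.Realizes 0 x y) :
    ∃ (p : B ⟶ A) (s : Z ⟶ B), x ≫ p = 𝟙 A ∧ s ≫ y = 𝟙 Z ∧ s ≫ p = 0 ∧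
      p ≫ x + y ≫ s = 𝟙 B := by
  obtain ⟨b, hx, hy⟩ := (T.realizes_iff (T.realizes_zero A Z) x y).1 h
  refine ⟨b.inv ≫ biprod.fst, biprod.inr ≫ b.hom, ?_, ?_, ?_, ?_⟩
  · simp [← hx]
  · simp [hy]
  · simp
  · have hy' : y = b.inv ≫ biprod.snd := by simp [← hy]
    rw [hy', ← hx]
    simp only [Category.assoc, ← Preadditive.comp_add]
    rw [← Category.assoc, ← Category.assoc, ← Preadditive.add_comp, biprod.total]
    simp

lemma realizes_of_isZero (φ : A ≅ B) (hZ : IsZero Z) :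
    T.Realizes (0 : Extn T.E Z A) φ.hom (0 : B ⟶ Z) :=
  realizes_zero_of_splitting φ.inv 0 (by simp) (hZ.eq_of_src _ _) (by simp) (by simp) (by simp)

lemma realizes_of_isZero_left (φ : B ≅ Z) (hA : IsZero A) :
    T.Realizes (0 : Extn T.E Z A) (0 : A ⟶ B) φ.hom :=
  realizes_zero_of_splitting 0 φ.inv (hA.eq_of_src _ _) (by simp) (by simp) (by simp) (by simp)

/-- The isomorphism between the middle terms of two realizations. -/
lemma exists_iso_of_realizes {B' : C} {x' : A ⟶ B'} {y' : B' ⟶ Z} (h : T.Realizes δ x y)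
    (h' : T.Realizes δ x' y') : ∃ b : B ≅ B', x ≫ b.hom = x' ∧ b.hom ≫ y' = y :=
  (T.realizes_iff h x' y').1 h'

lemma exists_factor_of_push_eq_zero (h : T.Realizes δ x y) {D : C} (f : A ⟶ D)
    (hf : push T.E Z f δ = 0) : ∃ g : B ⟶ D, x ≫ g = f := by
  obtain ⟨b, hb, -⟩ := T.exists_mid h (T.realizes_zero D Z) f (𝟙 Z) (by rw [hf, map_zero])
  exact ⟨b ≫ biprod.fst, by rw [← Category.assoc, hb]; simp⟩

lemma exists_factor_of_pull_eq_zero (h : T.Realizes δ x y) {D : C} (c : D ⟶ Z)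
    (hc : pull T.E A c δ = 0) : ∃ g : D ⟶ B, g ≫ y = c := by
  obtain ⟨b, -, hb⟩ := T.exists_mid (T.realizes_zero A D) h (𝟙 A) c (by rw [hc, map_zero])
  exact ⟨biprod.inr ≫ b, by rw [Category.assoc, ← hb]; simp⟩

lemma push_self (h : T.Realizes δ x y) : push T.E Z x δ = 0 := by
  obtain ⟨c, hc, -⟩ := T.exists_right h (T.realizes_zero B Z) x biprod.inl rfl
  rw [hc, map_zero]

lemma pull_self (h : T.Realizes δ x y) : pull T.E A y δ = 0 := by
  obtain ⟨c, hc, -⟩ := T.exists_left (T.realizes_zero A B) h biprod.snd y rfl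
  rw [← hc, map_zero]

lemma comp_eq_zero (h : T.Realizes δ x y) : x ≫ y = 0 := by
  obtain ⟨Z₀, hZ₀⟩ := HasZeroObject.zero (C := C)
  obtain ⟨c, -, hc⟩ := T.exists_right (realizes_of_isZero (T := T) (Iso.refl A) hZ₀) h (𝟙 A) x
    (by simp)
  rw [← hc, zero_comp]

/-- Exactness of `E(Z, -)` for extensions that are killed by pulling back to the middle term. -/
lemma exists_push_eq_of_pull_eq_zero (h : T.Realizes δ x y) {D : C} (ζ : Extn T.E Z D)
    (hζ : pull T.E D y ζ = 0) : ∃ a : A ⟶ D, push T.E Z a δ = ζ := by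
  obtain ⟨G, x', y', h'⟩ := T.exists_realizes ζ
  obtain ⟨b, hb⟩ := exists_factor_of_pull_eq_zero h' y hζ
  obtain ⟨a, ha, -⟩ := T.exists_left h h' b (𝟙 Z) (by rw [hb, Category.comp_id])
  exact ⟨a, by rw [ha, pull_id_apply]⟩

/-- Given `δ₁` realized by `A₁ ⟶ B₁ ⟶ Z` and `δ₂ ∈ E(Z, A₂)`, realized by `A₂ ⟶ B₂ ⟶ Z`, there is
a "fibre product" `P` of `B₁` and `B₂` over `Z`. -/
lemma exists_pullback_square {A₁ B₁ A₂ Z : C} {δ₁ : Extn T.E Z A₁} {x₁ : A₁ ⟶ B₁} {y₁ : B₁ ⟶ Z}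
    (h₁ : T.Realizes δ₁ x₁ y₁) (δ₂ : Extn T.E Z A₂) :
    ∃ (P B₂ : C) (m : A₂ ⟶ P) (p : P ⟶ B₁) (l : A₁ ⟶ P) (q : P ⟶ B₂) (x₂ : A₂ ⟶ B₂)
      (y₂ : B₂ ⟶ Z), T.Realizes (pull T.E A₂ y₁ δ₂) m p ∧ IsTriangle T l q ∧
      T.Realizes δ₂ x₂ y₂ ∧ m ≫ q = x₂ ∧ l ≫ p = x₁ ∧
      push T.E Z m δ₂ + push T.E Z l δ₁ = 0 := by
  obtain ⟨P, m, p, hmp⟩ := T.exists_realizes (pull T.E A₂ y₁ δ₂)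
  -- The kernel `H` of the composite `P ⟶ B₁ ⟶ Z` is an extension of `A₁` by `A₂` with class `x₁^*
  -- y₁^* δ₂ = 0`, so it splits.
  obtain ⟨H, d, e, h', δ, hδ, hd, he, hde, hδe, hδd⟩ := T.octahedron_op hmp h₁
  rw [← pull_comp_apply, comp_eq_zero h₁, T.pull_zero] at hde
  obtain ⟨p₀, s₀, hp₀, hs₀, -, hsum₀⟩ := exists_splitting hde
  have hde0 := comp_eq_zero hde
  obtain ⟨φ, hφ⟩ := exists_push_eq_of_pull_eq_zero h₁ (δ - push T.E Z d δ₂)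
    (by rw [map_sub, ← push_pull, hδd, sub_self])
  -- An arbitrary retraction `p₀` need not send `δ` to `δ₂`. The error `δ - d_* δ₂` equals `φ_* δ₁ =
  -- (e ≫ φ)_* δ`, and subtracting `e ≫ φ ≫ p₀` corrects it without changing the restriction to
  -- `A₂`.
  obtain ⟨p', hp', hpδ⟩ : ∃ p' : H ⟶ A₂, d ≫ p' = 𝟙 A₂ ∧ push T.E Z p' δ = δ₂ := by
    refine ⟨p₀ - e ≫ φ ≫ p₀, ?_, ?_⟩
    · rw [Preadditive.comp_sub, hp₀, ← Category.assoc, hde0, zero_comp, sub_zero]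
    · rw [T.push_sub, push_comp, push_comp, hδe, hφ, map_sub, ← push_comp _ _ d, hp₀, push_id,
        sub_sub_cancel]
  obtain ⟨s, hse, hsp, hsum⟩ : ∃ s : A₁ ⟶ H, s ≫ e = 𝟙 A₁ ∧ s ≫ p' = 0 ∧
      p' ≫ d + e ≫ s = 𝟙 H := by
    refine ⟨s₀ - s₀ ≫ p' ≫ d, ?_, ?_, ?_⟩
    · simp [hs₀, hde0]
    · simp [hp']
    · have h2 : e ≫ s₀ = 𝟙 H - p₀ ≫ d := by rw [← hsum₀]; abel
      rw [Preadditive.comp_sub, ← Category.assoc e, h2, Preadditive.sub_comp, Category.assoc p₀,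
        reassoc_of% hp', Category.id_comp]
      abel
  -- (ET4) for the split sequence `A₁ ⟶ H ⟶ A₂` followed by `H ⟶ P ⟶ Z`: dividing `P` by `A₁` leaves
  -- a realization of `p'_* δ = δ₂`.
  obtain ⟨B₂, q, x₂, y₂, δ'', h₁'', h₂'', h₃'', h₄'', -, -⟩ := T.octahedron
    (realizes_zero_of_splitting (T := T) (x := s) (y := p') e d hse hp' hsp hde0
      (by rw [add_comm]; exact hsum)) hδ
  rw [hpδ] at h₄''
  refine ⟨P, B₂, m, p, s ≫ h', q, x₂, y₂, hmp, ⟨_, h₁''⟩, h₄'', ?_, ?_, ?_⟩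
  · rw [← hd, Category.assoc, ← h₂'', ← Category.assoc, hp', Category.id_comp]
  · rw [Category.assoc, he, ← Category.assoc, hse, Category.id_comp]
  · rw [← hd, push_comp, push_comp, ← map_add]
    nth_rw 1 [← hpδ]
    rw [← hδe, ← push_comp, ← push_comp, ← T.push_add, hsum, push_id, push_self hδ]

/-- If the pullback of `ε ∈ E(B, D)` to `A` is realized by `D ⟶ F ⟶ A`, then the image of `ε` in
`E(B, F)` comes from `E(Z, F)`. -/
lemma exists_push_eq_pull (h : T.Realizes δ x y) {D : C} (ε : Extn T.E B D) :
    ∃ (F : C) (d : D ⟶ F) (e : F ⟶ A) (ζ : Extn T.E Z F),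
      T.Realizes (pull T.E D x ε) d e ∧ push T.E B d ε = pull T.E F y ζ := by
  obtain ⟨G, f', f, hf⟩ := T.exists_realizes ε
  obtain ⟨F, d, e, -, ζ, -, -, -, hde, -, hd⟩ := T.octahedron_op hf h
  exact ⟨F, d, e, ζ, hde, hd⟩

end

end Extriangulated

end Extri

/-! ### Cohomological presheaves -/

namespace Extri

/-- The restriction map of a presheaf of modules. -/
def res {R : Type r} [CommRing R] {C : Type u} [Category.{v} C] (P : Cᵒᵖ ⥤ ModuleCat.{t} R)
    {M N : C} (f : M ⟶ N) : P.obj (op N) →ₗ[R] P.obj (op M) :=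
  (P.map f.op).hom

section Presheaf

variable {R : Type r} [CommRing R] {C : Type u} [Category.{v} C] (P : Cᵒᵖ ⥤ ModuleCat.{t} R)

lemma res_id (M : C) (ξ : P.obj (op M)) : res P (𝟙 M) ξ = ξ := by
  simp [res]

lemma res_comp {M N K : C} (f : M ⟶ N) (g : N ⟶ K) (ξ : P.obj (op K)) :
    res P (f ≫ g) ξ = res P f (res P g ξ) := by
  simp [res]

end Presheaf

variable {R : Type r} [CommRing R] {C : Type u} [Category.{v} C] [Preadditive C] [Linear R C]
  [HasZeroObject C] [HasBinaryBiproducts C] (T : Extriangulated.{w} R C)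

/-- An `R`-linear presheaf that sends `E`-triangles to sequences which are exact in the middle. -/
structure IsCohomological (P : Cᵒᵖ ⥤ ModuleCat.{t} R) : Prop where
  res_add : ∀ {M N : C} (f g : M ⟶ N) (ξ : P.obj (op N)),
    res P (f + g) ξ = res P f ξ + res P g ξ
  res_smul : ∀ {M N : C} (c : R) (f : M ⟶ N) (ξ : P.obj (op N)),
    res P (c • f) ξ = c • res P f ξ
  exact : ∀ {A B Z : C} {δ : Extn T.E Z A} {x : A ⟶ B} {y : B ⟶ Z}, T.Realizes δ x y →
    ∀ ξ : P.obj (op B), res P x ξ = 0 → ∃ η : P.obj (op Z), res P y η = ξ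

namespace IsCohomological

variable {T} {P : Cᵒᵖ ⥤ ModuleCat.{t} R} (hP : IsCohomological T P)
include hP

lemma res_zero {M N : C} (ξ : P.obj (op N)) : res P (0 : M ⟶ N) ξ = 0 := by
  have := hP.res_smul 0 (0 : M ⟶ N) ξ
  rwa [zero_smul, zero_smul] at this

lemma res_sub {M N : C} (f g : M ⟶ N) (ξ : P.obj (op N)) :
    res P (f - g) ξ = res P f ξ - res P g ξ := by
  rw [eq_sub_iff_add_eq, ← hP.res_add, sub_add_cancel]

/-- Let `δ = h_* γ`. An element whose restriction along `h` extends to the middle term of `γ`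
extends to the middle term of `δ`. -/
lemma exists_res_eq_of_push {L G M W Z : C} {γ : Extn T.E Z L} {x₁ : L ⟶ G} {y₁ : G ⟶ Z}
    {δ : Extn T.E Z M} {x₂ : M ⟶ W} {y₂ : W ⟶ Z} (h₁ : T.Realizes γ x₁ y₁)
    (h₂ : T.Realizes δ x₂ y₂) (h : L ⟶ M) (hδ : push T.E Z h γ = δ) (ξ : P.obj (op M))
    (η : P.obj (op G)) (hη : res P x₁ η = res P h ξ) : ∃ ζ : P.obj (op W), res P x₂ ζ = ξ := by
  obtain ⟨H, W', m, p, l, q, x', y', hmp, ⟨ε, hlq⟩, h', hmq, hlp, hsum⟩ :=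
    Extriangulated.exists_pullback_square h₁ δ
  have hz : pull T.E M y₁ δ = 0 := by
    rw [← hδ, ← push_pull, Extriangulated.pull_self h₁, map_zero]
  have hmp0 := Extriangulated.comp_eq_zero hmp
  rw [hz] at hmp
  obtain ⟨ρ, -, hρ, -, -, -⟩ := Extriangulated.exists_splitting hmp
  have hpush : push T.E Z (h + l ≫ ρ) γ = 0 := by
    rw [T.push_add, hδ, push_comp]
    have := congrArg (push T.E Z ρ) hsum
    rwa [map_add, map_zero, ← push_comp, hρ, push_id] at this
  -- As `y₁^* δ = 0`, the fibre product `W'` is `M ⊕ G`, and `L ⟶ W' ⟶ W` plays the role of a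
  -- Mayer–Vietoris triangle. The map `u` measures how far `-l ≫ ρ` is from `h`.
  obtain ⟨u, hu⟩ := Extriangulated.exists_factor_of_push_eq_zero h₁ _ hpush
  have hl : res P (l ≫ ρ) ξ = res P x₁ (res P u ξ - η) := by
    rw [map_sub, hη, ← res_comp, hu, hP.res_add]
    abel
  -- This element of `P(W')` restricts to `ξ` along `m` and to zero along `l`, so it descends to
  -- `W`.
  obtain ⟨ζ, hζ⟩ := hP.exact hlq (res P ρ ξ - res P p (res P u ξ - η)) (by
    rw [map_sub, ← res_comp, ← res_comp, hl, hlp, sub_self])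
  obtain ⟨b, hb, -⟩ := Extriangulated.exists_iso_of_realizes h₂ h'
  refine ⟨res P b.hom ζ, ?_⟩
  rw [← res_comp, hb, ← hmq, res_comp, hζ, map_sub, ← res_comp, ← res_comp, hρ, hmp0, res_id,
    hP.res_zero, sub_zero]

end IsCohomological

/-! ### The direct limit of obstructions to extending an element -/

section Limit

/-- The extensions of `Z` by arbitrary objects. -/
structure ExtnOf (T : Extriangulated.{w} R C) (Z : C) where
  /-- the object by which `Z` is extended -/
  left : C
  /-- the extension -/
  ext : Extn T.E Z left

/-- An extension is above each of its pushforwards. -/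
instance (Z : C) : Preorder (ExtnOf T Z) where
  le i j := ∃ h : j.left ⟶ i.left, push T.E Z h j.ext = i.ext
  le_refl i := ⟨𝟙 _, push_id _ _ _ _⟩
  le_trans i j k := fun ⟨h, hh⟩ ⟨h', hh'⟩ => ⟨h' ≫ h, by rw [push_comp, hh', hh]⟩

-- Two extensions of `Z` are pushforwards of a single one, by the direct sum of their left terms.
-- Directedness, additivity of obstructions and the reduction to pure tensors all rest on this.
variable {T} in
lemma push_biprod {Z M N : C} (δ : Extn T.E Z M) (ε : Extn T.E Z N) :
    push T.E Z biprod.fst (push T.E Z (biprod.inl : M ⟶ M ⊞ N) δ + push T.E Z biprod.inr ε) = δ ∧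
    push T.E Z biprod.snd (push T.E Z (biprod.inl : M ⟶ M ⊞ N) δ + push T.E Z biprod.inr ε) = ε := by
  constructor <;>
  simp only [map_add, ← push_comp, biprod.inl_fst, biprod.inr_fst, biprod.inl_snd, biprod.inr_snd,
    push_id, T.push_zero, add_zero, zero_add]

instance (Z : C) : IsDirectedOrder (ExtnOf T Z) where
  directed i j := ⟨⟨i.left ⊞ j.left, push T.E Z biprod.inl i.ext + push T.E Z biprod.inr j.ext⟩,
    ⟨biprod.fst, (push_biprod _ _).1⟩, ⟨biprod.snd, (push_biprod _ _).2⟩⟩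

variable (P : Cᵒᵖ ⥤ ModuleCat.{t} R)

/-- The elements of `P(A)` that extend to the middle term of a realization of `δ ∈ E(Z, A)`. -/
noncomputable def extendable {A Z : C} (δ : Extn T.E Z A) : Submodule R (P.obj (op A)) :=
  LinearMap.range (res P (T.exists_realizes δ).choose_spec.choose)

variable {T} in
lemma mem_extendable {A B Z : C} {δ : Extn T.E Z A} {x : A ⟶ B} {y : B ⟶ Z}
    (h : T.Realizes δ x y) (ξ : P.obj (op A)) :
    ξ ∈ extendable T P δ ↔ ∃ η, res P x η = ξ := by
  obtain ⟨b, hb, -⟩ := Extriangulated.exists_iso_of_realizes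
    (T.exists_realizes δ).choose_spec.choose_spec.choose_spec h
  constructor
  · rintro ⟨η, rfl⟩
    exact ⟨res P b.inv η, by rw [← res_comp, ← hb, Category.assoc, b.hom_inv_id, Category.comp_id]⟩
  · rintro ⟨η, rfl⟩
    exact ⟨res P b.hom η, by rw [← res_comp, hb]⟩

variable {T} in
lemma res_mem_extendable {L M Z : C} {γ : Extn T.E Z L} {δ : Extn T.E Z M} (h : L ⟶ M)
    (hδ : push T.E Z h γ = δ) {ξ : P.obj (op M)} (hξ : ξ ∈ extendable T P δ) :
    res P h ξ ∈ extendable T P γ := by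
  obtain ⟨G, x, y, h₁⟩ := T.exists_realizes γ
  obtain ⟨W, x', y', h₂⟩ := T.exists_realizes δ
  obtain ⟨η, rfl⟩ := (mem_extendable P h₂ ξ).1 hξ
  obtain ⟨b, hb, -⟩ := T.exists_mid h₁ h₂ h (𝟙 Z) (by rw [hδ, pull_id_apply])
  exact (mem_extendable P h₁ _).2 ⟨res P b η, by rw [← res_comp, ← res_comp, hb]⟩

/-- The quotient of `P(A)` by the elements that extend to the middle term. -/
abbrev Obstruction {Z : C} (i : ExtnOf T Z) : Type t :=
  P.obj (op i.left) ⧸ extendable T P i.ext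

/-- The transition maps between the modules of obstructions. -/
noncomputable def obstructionMap {Z : C} (i j : ExtnOf T Z) (hij : i ≤ j) :
    Obstruction T P i →ₗ[R] Obstruction T P j :=
  Submodule.mapQ _ _ (res P hij.choose) fun _ hξ => res_mem_extendable P _ hij.choose_spec hξ

variable {T P} (hP : IsCohomological T P)

-- The chosen transition morphism is irrelevant: two morphisms with the same pushforward differ by
-- one that kills the extension, hence factors through the middle term, and so changes restrictions
-- only by extendable elements.
include hP in
lemma obstructionMap_mk {Z : C} {i j : ExtnOf T Z} (hij : i ≤ j) (h : j.left ⟶ i.left)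
    (hh : push T.E Z h j.ext = i.ext) (ξ : P.obj (op i.left)) :
    obstructionMap T P i j hij (Submodule.Quotient.mk ξ) = Submodule.Quotient.mk (res P h ξ) := by
  rw [obstructionMap, Submodule.mapQ_apply, Submodule.Quotient.eq, ← hP.res_sub]
  obtain ⟨G, x, y, hxy⟩ := T.exists_realizes j.ext
  obtain ⟨g, hg⟩ := Extriangulated.exists_factor_of_push_eq_zero hxy (hij.choose - h)
    (by rw [T.push_sub, hij.choose_spec, hh, sub_self])
  exact (mem_extendable P hxy _).2 ⟨res P g ξ, by rw [← res_comp, hg]⟩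

include hP in
lemma directedSystem_obstruction (Z : C) :
    DirectedSystem (Obstruction T P (Z := Z)) (obstructionMap T P · · ·) where
  map_self i ξ := by
    obtain ⟨ξ, rfl⟩ := Submodule.Quotient.mk_surjective _ ξ
    rw [obstructionMap_mk hP _ (𝟙 _) (push_id _ _ _ _), res_id]
  map_map k j i hij hjk ξ := by
    obtain ⟨ξ, rfl⟩ := Submodule.Quotient.mk_surjective _ ξ
    obtain ⟨h, hh⟩ := hij
    obtain ⟨h', hh'⟩ := hjk
    rw [obstructionMap_mk hP _ h hh, obstructionMap_mk hP _ h' hh',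
      obstructionMap_mk hP _ (h' ≫ h) (by rw [push_comp, hh', hh]), res_comp]

open Classical in
variable (T P) in
/-- The direct limit of the modules of obstructions over all extensions of `Z`. -/
abbrev ObstructionLimit (Z : C) :=
  Module.DirectLimit (Obstruction T P (Z := Z)) (obstructionMap T P)

open Classical in
variable (T P) in
/-- The class of `ξ ∈ P(M)` in the direct limit, in the summand of `δ ∈ E(Z, M)`. -/
noncomputable def obstruction {Z M : C} (δ : Extn T.E Z M) :
    P.obj (op M) →ₗ[R] ObstructionLimit T P Z :=
  Module.DirectLimit.of R _ (Obstruction T P (Z := Z)) (obstructionMap T P) ⟨M, δ⟩ ∘ₗ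
    Submodule.mkQ _

include hP

lemma obstruction_res {Z L M : C} (h : L ⟶ M) (γ : Extn T.E Z L) (ξ : P.obj (op M)) :
    obstruction T P γ (res P h ξ) = obstruction T P (push T.E Z h γ) ξ := by
  classical
  have hle : (⟨M, push T.E Z h γ⟩ : ExtnOf T Z) ≤ ⟨L, γ⟩ := ⟨h, rfl⟩
  have := Module.DirectLimit.of_f (R := R) (f := obstructionMap T P) (hij := hle)
    (x := Submodule.Quotient.mk ξ)
  rw [obstructionMap_mk hP hle h rfl] at this
  exact this

/-- Vanishing in a directed limit happens at some stage `j`, of which `δ` is a pushforward;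
`exists_res_eq_of_push` carries extendability from `j` back to `δ`. -/
lemma extendable_of_obstruction_eq_zero {Z M : C} (δ : Extn T.E Z M) (ξ : P.obj (op M))
    (h : obstruction T P δ ξ = 0) : ξ ∈ extendable T P δ := by
  classical
  have := directedSystem_obstruction hP Z
  obtain ⟨j, ⟨f, hf⟩, hj⟩ := Module.DirectLimit.of.zero_exact h
  rw [Submodule.mkQ_apply, obstructionMap_mk hP _ f hf, Submodule.Quotient.mk_eq_zero] at hj
  obtain ⟨G, x₁, y₁, h₁⟩ := T.exists_realizes j.ext
  obtain ⟨W, x₂, y₂, h₂⟩ := T.exists_realizes δ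
  obtain ⟨η, hη⟩ := (mem_extendable P h₁ _).1 hj
  exact (mem_extendable P h₂ _).2 (hP.exists_res_eq_of_push h₁ h₂ f hf ξ η hη)

/-- With `δ` and `ε` written as the pushforwards of one `ζ` along the two projections, additivity in
the extension becomes additivity of `res` in the morphism. -/
lemma obstruction_add {Z M : C} (δ ε : Extn T.E Z M) (ξ : P.obj (op M)) :
    obstruction T P (δ + ε) ξ = obstruction T P δ ξ + obstruction T P ε ξ := by
  obtain ⟨h₁, h₂⟩ := push_biprod δ ε
  generalize push T.E Z (biprod.inl : M ⟶ M ⊞ M) δ + push T.E Z biprod.inr ε = ζ at h₁ h₂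
  rw [← h₁, ← h₂, ← T.push_add, ← obstruction_res hP, ← obstruction_res hP, ← obstruction_res hP,
    hP.res_add, map_add]

lemma obstruction_smul {Z M : C} (c : R) (δ : Extn T.E Z M) (ξ : P.obj (op M)) :
    obstruction T P (c • δ) ξ = c • obstruction T P δ ξ := by
  have := T.push_smul c (𝟙 M) δ
  rw [push_id] at this
  rw [← this, ← obstruction_res hP, hP.res_smul, res_id, map_smul]

end Limit

/-! ### Exactness of the tensor product with `E` -/

section Tensor

variable {T} {P : Cᵒᵖ ⥤ ModuleCat.{max u w} R}

variable (T P) in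
/-- The class of `ξ ⊗ δ` in `(P ⊗ E)(Z)`. -/
noncomputable def tmul {Z M : C} (ξ : P.obj (op M)) (δ : Extn T.E Z M) :
    (tensorFunctor T.E P).obj (op Z) :=
  Submodule.Quotient.mk (p := tensorRel T.E P Z) (preTmul T.E P Z M ξ δ)

lemma tmul_add {Z M : C} (ξ : P.obj (op M)) (δ ε : Extn T.E Z M) :
    tmul T P ξ (δ + ε) = tmul T P ξ δ + tmul T P ξ ε := by
  rw [tmul, preTmul, TensorProduct.tmul_add, map_add]
  rfl

lemma add_tmul {Z M : C} (ξ η : P.obj (op M)) (δ : Extn T.E Z M) :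
    tmul T P (ξ + η) δ = tmul T P ξ δ + tmul T P η δ := by
  rw [tmul, preTmul, TensorProduct.add_tmul, map_add]
  rfl

lemma tmul_smul {Z M : C} (c : R) (ξ : P.obj (op M)) (δ : Extn T.E Z M) :
    tmul T P ξ (c • δ) = c • tmul T P ξ δ := by
  rw [tmul, preTmul, TensorProduct.tmul_smul, map_smul]
  rfl

lemma zero_tmul {Z M : C} (δ : Extn T.E Z M) : tmul T P 0 δ = 0 := by
  rw [tmul, preTmul, TensorProduct.zero_tmul, map_zero]
  rfl

lemma tmul_push {Z M N : C} (f : M ⟶ N) (ξ : P.obj (op N)) (δ : Extn T.E Z M) :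
    tmul T P ξ (push T.E Z f δ) = tmul T P (res P f ξ) δ :=
  ((Submodule.Quotient.eq (tensorRel T.E P Z)).2
    (Submodule.subset_span ⟨M, N, f, ξ, δ, rfl⟩)).symm

lemma res_tmul {Z' Z M : C} (c : Z' ⟶ Z) (ξ : P.obj (op M)) (δ : Extn T.E Z M) :
    res (tensorFunctor T.E P) c (tmul T P ξ δ) = tmul T P ξ (pull T.E M c δ) := by
  change Submodule.mapQ _ _ (preTensorMap T.E P c) (tensorRel_le_comap T.E P c)
    (Submodule.Quotient.mk _) = _
  rw [Submodule.mapQ_apply, preTensorMap_preTmul]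
  rfl

/-- Every element of `(P ⊗ E)(Z)` is a pure tensor. -/
lemma exists_tmul_eq {Z : C} (t : (tensorFunctor T.E P).obj (op Z)) :
    ∃ (M : C) (ξ : P.obj (op M)) (δ : Extn T.E Z M), tmul T P ξ δ = t := by
  classical
  have hadd : ∀ s t : (tensorFunctor T.E P).obj (op Z),
      (∃ (M : C) (ξ : P.obj (op M)) (δ : Extn T.E Z M), tmul T P ξ δ = s) →
      (∃ (M : C) (ξ : P.obj (op M)) (δ : Extn T.E Z M), tmul T P ξ δ = t) →
      ∃ (M : C) (ξ : P.obj (op M)) (δ : Extn T.E Z M), tmul T P ξ δ = s + t := by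
    rintro _ _ ⟨M, ξ, δ, rfl⟩ ⟨N, η, ε, rfl⟩
    obtain ⟨h₁, h₂⟩ := push_biprod δ ε
    refine ⟨M ⊞ N, res P biprod.fst ξ + res P biprod.snd η,
      push T.E Z biprod.inl δ + push T.E Z biprod.inr ε, ?_⟩
    rw [add_tmul, ← tmul_push, ← tmul_push, h₁, h₂]
  obtain ⟨t, rfl⟩ := Submodule.Quotient.mk_surjective _ t
  induction t using DirectSum.induction_on with
  | zero => exact ⟨Z, 0, 0, zero_tmul _⟩
  | of M t =>
    induction t using TensorProduct.induction_on with
    | zero => exact ⟨Z, 0, 0, by rw [zero_tmul, map_zero]; rfl⟩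
    | tmul ξ δ => exact ⟨M, ξ, δ, rfl⟩
    | add s t hs ht => rw [map_add]; exact hadd _ _ hs ht
  | add s t hs ht => exact hadd _ _ hs ht

namespace IsCohomological

variable (hP : IsCohomological T P)
include hP

/-- Exactness of `P(B) ⟶ P(A) ⟶ (P ⊗ E)(Z)` for an `E`-triangle `A ⟶ B ⟶ Z`. -/
lemma exists_res_eq_of_tmul_eq_zero {A B Z : C} {δ : Extn T.E Z A} {x : A ⟶ B} {y : B ⟶ Z}
    (h : T.Realizes δ x y) (ξ : P.obj (op A)) (hξ : tmul T P ξ δ = 0) :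
    ∃ η : P.obj (op B), res P x η = ξ := by
  classical
  -- The obstruction is bilinear and satisfies the coend relations, because these relations are the
  -- transition maps of the limit. It therefore detects whether `ξ ⊗ δ` vanishes.
  let φ : PreTensor T.E P Z →ₗ[R] ObstructionLimit T P Z :=
    DirectSum.toModule R C _ fun M => TensorProduct.lift (LinearMap.flip
      { toFun := fun δ => obstruction T P δ
        map_add' := fun δ ε => LinearMap.ext fun ξ => obstruction_add hP δ ε ξ
        map_smul' := fun c δ => LinearMap.ext fun ξ => obstruction_smul hP c δ ξ })
  have hφ : ∀ (M : C) (ξ : P.obj (op M)) (δ : Extn T.E Z M),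
      φ (preTmul T.E P Z M ξ δ) = obstruction T P δ ξ := fun M ξ δ => by
    simp only [φ, preTmul]
    rw [DirectSum.toModule_lof]
    rfl
  have hker : tensorRel T.E P Z ≤ LinearMap.ker φ := by
    refine Submodule.span_le.2 ?_
    rintro _ ⟨M, N, f, η, ε, rfl⟩
    rw [SetLike.mem_coe, LinearMap.mem_ker, map_sub, hφ, hφ, ← obstruction_res hP]
    exact sub_self _
  have := hker ((Submodule.Quotient.mk_eq_zero _).1 hξ)
  rw [LinearMap.mem_ker, hφ] at this
  exact (mem_extendable P h _).1 (extendable_of_obstruction_eq_zero hP δ ξ this)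

/-- If `ξ ⊗ x^* ε = 0`, then `ξ = d^* η` for the middle term `F` of `x^* ε`. As `d_* ε = y^* ζ`, one
gets `ξ ⊗ ε = η ⊗ d_* ε = y^* (η ⊗ ζ)`. -/
lemma tensorFunctor : IsCohomological T (tensorFunctor T.E P) where
  res_add f g t := by
    obtain ⟨M, ξ, δ, rfl⟩ := exists_tmul_eq t
    rw [res_tmul, res_tmul, res_tmul, T.pull_add, tmul_add]
  res_smul c f t := by
    obtain ⟨M, ξ, δ, rfl⟩ := exists_tmul_eq t
    rw [res_tmul, res_tmul, T.pull_smul, tmul_smul]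
  exact {A B Z δ x y} h t ht := by
    obtain ⟨M, ξ, ε, rfl⟩ := exists_tmul_eq t
    rw [res_tmul] at ht
    obtain ⟨F, d, e, ζ, hde, hd⟩ := Extriangulated.exists_push_eq_pull h ε
    obtain ⟨η, rfl⟩ := hP.exists_res_eq_of_tmul_eq_zero hde ξ ht
    exact ⟨tmul T P η ζ, by rw [res_tmul, ← hd, tmul_push]⟩

end IsCohomological

variable (T) in
/-- The higher extension functors `E^k(-, A)` are cohomological. -/
lemma isCohomological_higherExt (A : C) (k : ℕ) : IsCohomological T (higherExt T.E A k) := by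
  induction k with
  | zero =>
    refine ⟨fun f g ξ => ?_, fun c f ξ => ?_, fun {A' B Z δ x y} h ξ hξ => ?_⟩
    · exact congrArg ULift.up (T.pull_add f g ξ.down)
    · exact congrArg ULift.up (T.pull_smul c f ξ.down)
    · have hξ' : pull T.E A x ξ.down = 0 := congrArg ULift.down hξ
      obtain ⟨F, d, e, ζ, hde, hd⟩ := Extriangulated.exists_push_eq_pull h ξ.down
      rw [hξ'] at hde
      obtain ⟨p, -, hp, -⟩ := Extriangulated.exists_splitting hde
      -- The extension `x^* ξ = 0` splits, so the retraction `p` of `d` turns `d_* ξ = y^* ζ` into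
      -- `ξ = y^* p_* ζ`.
      refine ⟨ULift.up (push T.E Z p ζ), ?_⟩
      refine congrArg ULift.up (a₁ := pull T.E A y (push T.E Z p ζ)) (a₂ := ξ.down) ?_
      rw [← push_pull, ← hd, ← push_comp, hp, push_id]
  | succ k ih => exact ih.tensorFunctor

end Tensor

end Extri

/-! ### Relative coresolutions and approximations -/

namespace Extri

section Relative

variable {R : Type r} [CommRing R] {C : Type u} [Category.{v} C] [Preadditive C] [Linear R C]
  [HasZeroObject C] [HasBinaryBiproducts C] {T : Extriangulated.{w} R C} {𝒳 𝒴 ω : ObjectProperty C}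

lemma ClosedUnderExt.of_iso (hX : ClosedUnderExt T 𝒳) (h0 : 𝒳.ContainsZero) {A B : C} (φ : A ≅ B)
    (hA : 𝒳 A) : 𝒳 B := by
  obtain ⟨Z, hZ, hXZ⟩ := h0.exists_zero
  exact hX φ.hom 0 ⟨0, Extriangulated.realizes_of_isZero φ hZ⟩ hA hXZ

lemma ClosedUnderExt.of_isZero (hX : ClosedUnderExt T 𝒳) (h0 : 𝒳.ContainsZero) {Z : C}
    (hZ : IsZero Z) : 𝒳 Z := by
  obtain ⟨Z', hZ', hXZ⟩ := h0.exists_zero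
  exact hX.of_iso h0 (hZ'.iso hZ) hXZ

lemma HasCores.mono {𝒳' 𝒴' : ObjectProperty C} (hX : 𝒳 ≤ 𝒳') (hY : 𝒴 ≤ 𝒴') :
    ∀ {n : ℕ} {M : C}, HasCores T 𝒳 𝒴 n M → HasCores T 𝒳' 𝒴' n M
  | 0, _, ⟨N, ⟨h₁, h₂⟩, e⟩ => ⟨N, ⟨hX _ h₁, hY _ h₂⟩, e⟩
  | _ + 1, _, ⟨Y, N, x, y, h, hY', hN, hc⟩ =>
    ⟨Y, N, x, y, h, hY _ hY', hX _ hN, HasCores.mono hX hY hc⟩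

lemma coresdim_le {n : ℕ} {M : C} (h : HasCores T 𝒳 𝒴 n M) : coresdim T 𝒳 𝒴 M ≤ n :=
  sInf_le ⟨n, rfl, h⟩

lemma hasCores_of_coresdim_eq {n : ℕ} {M : C} (h : coresdim T 𝒳 𝒴 M = n) :
    HasCores T 𝒳 𝒴 n M := by
  have hne : {m : ℕ∞ | ∃ k : ℕ, m = k ∧ HasCores T 𝒳 𝒴 k M}.Nonempty := by
    by_contra hne
    rw [Set.not_nonempty_iff_eq_empty] at hne
    rw [coresdim, hne, sInf_empty] at h
    exact ENat.natCast_ne_top n h.symm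
  obtain ⟨k, hk, hc⟩ := csInf_mem hne
  rw [← coresdim, h, Nat.cast_inj] at hk
  rwa [hk]

/-- A zero object has a finite `ω_𝒴`-coresolution, even if it does not belong to `ω`. -/
lemma coresClass_of_isZero (hω : IsRelGenerator T ω 𝒳) (hXY : 𝒳 ≤ 𝒴) (h0 : 𝒳.ContainsZero) {Z : C}
    (hZ : IsZero Z) : coresClass T 𝒴 ω Z := by
  obtain ⟨X, -, hX⟩ := h0.exists_zero
  obtain ⟨-, W, -, -, -, -, hW⟩ := hω.2 X hX
  have hWY := hXY _ (hω.1 _ hW)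
  exact ⟨1, W, W, 0, 𝟙 W, ⟨0, Extriangulated.realizes_of_isZero_left (Iso.refl W) hZ⟩, hW, hWY,
    W, ⟨hWY, hW⟩, ⟨Iso.refl W⟩⟩

/-- Given `M` in `𝒳` and an `E`-triangle `Z ⟶ M ⟶ N` such that `N` is in `𝒴` and has an
`ω_𝒴`-coresolution of length `n`, there is an `E`-triangle `K ⟶ B ⟶ Z` such that `K` is in `𝒳` and
`B` has an `ω_𝒴`-coresolution of length `n + 1`. -/
lemma exists_triangle_of_hasCores (hω : IsRelGenerator T ω 𝒳) {Z M N : C} {g : Z ⟶ M} {q : M ⟶ N}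
    (h : IsTriangle T g q) (hM : 𝒳 M) (hN : 𝒴 N) {n : ℕ} (hc : HasCores T 𝒴 ω n N) :
    ∃ (K B : C) (i : K ⟶ B) (f : B ⟶ Z), IsTriangle T i f ∧ 𝒳 K ∧ HasCores T 𝒴 ω (n + 1) B := by
  obtain ⟨K, W, x, y, ⟨δ, hδ⟩, hK, hW⟩ := hω.2 M hM
  obtain ⟨δ', hδ'⟩ := h
  obtain ⟨B, i, f, h', ε, hε, -, -, hif, -, -⟩ := T.octahedron_op hδ hδ'
  exact ⟨K, B, i, f, ⟨_, hif⟩, hK, W, N, h', _, ⟨ε, hε⟩, hW, hN, hc⟩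

/-- Replace a triangle `Z ⟶ X ⟶ N` by pulling back along `K ⟶ B ⟶ N`. -/
lemma exists_triangle_pullback (hX : ClosedUnderExt T 𝒳) (h0 : 𝒳.ContainsZero) {Z X N K B : C}
    {x : Z ⟶ X} {y : X ⟶ N} {i : K ⟶ B} {f : B ⟶ N} (h : IsTriangle T x y) (h' : IsTriangle T i f)
    (hX' : 𝒳 X) (hK : 𝒳 K) :
    ∃ (M : C) (g : Z ⟶ M) (q : M ⟶ B), IsTriangle T g q ∧ 𝒳 M := by
  obtain ⟨δ, hδ⟩ := h
  obtain ⟨γ, hγ⟩ := h'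
  obtain ⟨M, X', g, q, l, p, x', y', hgq, hlp, hδ', -, -, -⟩ :=
    Extriangulated.exists_pullback_square hγ δ
  obtain ⟨b, -, -⟩ := Extriangulated.exists_iso_of_realizes hδ hδ'
  exact ⟨M, g, q, ⟨_, hgq⟩, hX l p hlp hK (hX.of_iso h0 b hX')⟩

/-- The approximations of an object with a finite `𝒳_𝒴`-coresolution. -/
lemma exists_approximations (hXY : 𝒳 ≤ 𝒴) (hX : ClosedUnderExt T 𝒳) (hY : ClosedUnderExt T 𝒴)
    (hω : IsRelGenerator T ω 𝒳) (h0 : 𝒳.ContainsZero) (n : ℕ) (Z : C) (hZ : HasCores T 𝒴 𝒳 n Z) :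
    (∃ (M N : C) (g : Z ⟶ M) (q : M ⟶ N), IsTriangle T g q ∧ 𝒳 M ∧ pairClass T 𝒴 ω N ∧
      (1 ≤ n → ∃ m, m + 1 ≤ n ∧ HasCores T 𝒴 ω m N) ∧ (n = 0 → IsZero N)) ∧
    (∃ (K B : C) (i : K ⟶ B) (f : B ⟶ Z), IsTriangle T i f ∧ 𝒳 K ∧
      ∃ m, m ≤ n ∧ HasCores T 𝒴 ω m B) := by
  have h0Y : 𝒴.ContainsZero := ⟨let ⟨A, hA, hA'⟩ := h0.exists_zero; ⟨A, hA, hXY _ hA'⟩⟩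
  induction n generalizing Z with
  | zero =>
    obtain ⟨X, ⟨-, hX'⟩, ⟨e⟩⟩ := hZ
    have hZX := hX.of_iso h0 e.symm hX'
    obtain ⟨O, hO⟩ := HasZeroObject.zero (C := C)
    obtain ⟨K, W, x, y, hxy, hK, hW⟩ := hω.2 Z hZX
    exact ⟨⟨Z, O, 𝟙 Z, 0, ⟨0, Extriangulated.realizes_of_isZero (Iso.refl Z) hO⟩, hZX,
      ⟨hY.of_isZero h0Y hO, coresClass_of_isZero hω hXY h0 hO⟩, by simp, fun _ => hO⟩,
      K, W, x, y, hxy, hK, 0, le_rfl, W, ⟨hXY _ (hω.1 _ hW), hW⟩, ⟨Iso.refl W⟩⟩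
  | succ n ih =>
    obtain ⟨X, N, x, y, hxy, hX', hN, hc⟩ := hZ
    obtain ⟨-, K, B, i, f, hif, hK, m, hm, hB⟩ := ih N hc
    -- `B` serves as `C_Z`. It lies in `𝒴` as an extension of `N` by `K`, which is why `N` is
    -- required to be in `𝒴` along the coresolution.
    obtain ⟨M, g, q, hgq, hM⟩ := exists_triangle_pullback hX h0 hxy hif hX' hK
    have hBY := hY i f hif (hXY _ hK) hN
    obtain ⟨K', B', i', f', hif', hK', hB'⟩ := exists_triangle_of_hasCores hω hgq hM hBY hB
    exact ⟨⟨M, B, g, q, hgq, hM, ⟨hBY, m, hB⟩, fun _ => ⟨m, by lia, hB⟩, by simp⟩,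
      K', B', i', f', hif', hK', m + 1, by lia, hB'⟩

lemma leftOrth_of_iso {A B : C} (φ : A ≅ B) (hA : leftOrth T 𝒳 A) : leftOrth T 𝒳 B := by
  intro X hX k ξ
  rw [← res_id _ B ξ, ← φ.inv_hom_id, res_comp, hA X hX k (res _ φ.hom ξ), map_zero]

/-- Dimension shift: `ξ ⊗ δ` lies in the next extension group of `Z`, which vanishes, so `ξ` is the
restriction of a class on `B`, which vanishes too. -/
lemma leftOrth_of_isTriangle {A B Z : C} {x : A ⟶ B} {y : B ⟶ Z} (h : IsTriangle T x y)
    (hB : leftOrth T 𝒳 B) (hZ : leftOrth T 𝒳 Z) : leftOrth T 𝒳 A := by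
  intro X hX k ξ
  obtain ⟨δ, hδ⟩ := h
  obtain ⟨η, rfl⟩ := (isCohomological_higherExt T X k).exists_res_eq_of_tmul_eq_zero hδ ξ
    (hZ X hX (k + 1) _)
  rw [hB X hX k η, map_zero]

lemma leftOrth_of_hasCores (hω : ω ≤ leftOrth T 𝒳) :
    ∀ {n : ℕ} {M : C}, HasCores T 𝒴 ω n M → leftOrth T 𝒳 M
  | 0, _, ⟨_, ⟨_, h⟩, ⟨e⟩⟩ => leftOrth_of_iso e.symm (hω _ h)
  | _ + 1, _, ⟨_, _, _, _, h, hY, _, hc⟩ =>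
    leftOrth_of_isTriangle h (hω _ hY) (leftOrth_of_hasCores hω hc)

lemma eq_zero_of_leftOrth {M X : C} (hM : leftOrth T 𝒳 M) (hX : 𝒳 X) (δ : Extn T.E M X) : δ = 0 :=
  congrArg ULift.down (hM X hX 0 (ULift.up δ))

end Relative

end Extri

theorem theorem3p3 {R : Type r} [CommRing R] {C : Type u} [Category.{v} C] [Preadditive C]
    [Linear R C] [HasZeroObject C] [HasBinaryBiproducts C]
    (T : Extri.Extriangulated.{w} R C) (𝒳 𝒴 ω : ObjectProperty C) (hXY : 𝒳 ≤ 𝒴)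
    (hX : Extri.ClosedUnderExt T 𝒳) (hY : Extri.ClosedUnderExt T 𝒴)
    (hω : Extri.IsRelGenerator T ω 𝒳) (h0 : 𝒳.ContainsZero) :
    -- (1)
    (∀ (Z : C) (n : ℕ), Extri.coresdim T 𝒴 𝒳 Z = n →
      (∃ (M_Z C_Z : C) (g : Z ⟶ M_Z) (q : M_Z ⟶ C_Z), Extri.IsTriangle T g q ∧
        𝒳 M_Z ∧ Extri.pairClass T 𝒴 ω C_Z ∧
        (1 ≤ n → Extri.coresdim T 𝒴 ω C_Z = ((n - 1 : ℕ) : ℕ∞)) ∧ (n = 0 → IsZero C_Z)) ∧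
      (∃ (K_Z B_Z : C) (i : K_Z ⟶ B_Z) (f : B_Z ⟶ Z), Extri.IsTriangle T i f ∧
        𝒳 K_Z ∧ Extri.coresClass T 𝒴 ω B_Z ∧ Extri.coresdim T 𝒴 ω B_Z ≤ n)) ∧
    -- (2)
    (∀ (Z K_Z B_Z : C) (i : K_Z ⟶ B_Z) (f : B_Z ⟶ Z), Extri.IsTriangle T i f →
      𝒳 K_Z → Extri.coresClass T 𝒴 ω B_Z →
      Extri.pairClass T 𝒴 𝒳 Z → Extri.pairClass T 𝒴 ω B_Z) ∧
    -- (3)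
    (ω ≤ Extri.leftOrth T 𝒳 →
      Extri.coresClass T ⊤ ω ≤ Extri.leftOrth T 𝒳 ∧
      (∀ (Z K_Z B_Z : C) (i : K_Z ⟶ B_Z) (f : B_Z ⟶ Z), Extri.IsTriangle T i f →
        𝒳 K_Z → Extri.coresClass T 𝒴 ω B_Z →
        Extri.IsPrecover (Extri.coresClass T ⊤ ω) f) ∧
      (∀ (Z M_Z C_Z : C) (g : Z ⟶ M_Z) (q : M_Z ⟶ C_Z), Extri.IsTriangle T g q →
        𝒳 M_Z → Extri.pairClass T 𝒴 ω C_Z →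
        Extri.IsPreenvelope 𝒳 g)) := by
  refine ⟨fun Z n hn => ?_, fun Z K B i f hif hK hB hZ => ⟨hY i f hif (hXY _ hK) hZ.1, hB⟩,
    fun horth => ⟨fun M ⟨n, hM⟩ => Extri.leftOrth_of_hasCores horth hM, ?_, ?_⟩⟩
  · obtain ⟨⟨M, N, g, q, hgq, hM, hN, hdim, hzero⟩, K, B, i, f, hif, hK, m, hm, hB⟩ :=
      Extri.exists_approximations hXY hX hY hω h0 n Z (Extri.hasCores_of_coresdim_eq hn)
    refine ⟨⟨M, N, g, q, hgq, hM, hN, fun hn1 => ?_, hzero⟩, K, B, i, f, hif, hK, ⟨m, hB⟩,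
      (Extri.coresdim_le hB).trans (Nat.cast_le.2 hm)⟩
    obtain ⟨m, hm, hc⟩ := hdim hn1
    refine le_antisymm ((Extri.coresdim_le hc).trans (Nat.cast_le.2 (by lia))) (le_sInf ?_)
    rintro _ ⟨k, rfl, hk⟩
    -- Minimality of `n`: since `ω ⊆ 𝒳`, a coresolution of `C_Z` of length `k` extends through `M_Z`
    -- to one of `Z` of length `k + 1`, whence `n ≤ k + 1`.
    have hZ : Extri.HasCores T 𝒴 𝒳 (k + 1) Z :=
      ⟨M, N, g, q, hgq, hM, hN.1, hk.mono le_rfl hω.1⟩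
    have := Extri.coresdim_le hZ
    rw [hn, Nat.cast_le] at this
    exact Nat.cast_le.2 (by lia)
  · rintro Z K B i f ⟨δ, hδ⟩ hK ⟨n, hB⟩
    refine ⟨⟨n, hB.mono le_top le_rfl⟩, fun V ⟨m, hV⟩ h => ?_⟩
    exact Extri.Extriangulated.exists_factor_of_pull_eq_zero hδ h
      (Extri.eq_zero_of_leftOrth (Extri.leftOrth_of_hasCores horth hV) hK _)
  · rintro Z M N g q ⟨δ, hδ⟩ hM ⟨-, n, hN⟩
    refine ⟨hM, fun V hV h => ?_⟩
    exact Extri.Extriangulated.exists_factor_of_push_eq_zero hδ h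
      (Extri.eq_zero_of_leftOrth (Extri.leftOrth_of_hasCores horth hN) hV _)
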